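/- BIPASS is played by Left and Right on a strip, i.e. a finite row of black stones $\bullet$ and white stones $\circ$. A move interchanges a black stone and a white stone lying somewhere to its right; Left may do so only if no black stone lies strictly between them, Right only if no white stone lies strictly between them. A stone is dead if it is black and has no white stone to its right, or white and has no black stone to its left; dead stones are removed after every move, and a strip is assumed to have no dead stones. A player who cannot move loses (normal play). Write $G\equiv H$ for equality of game values: $G+X$ and $H+X$ have the same outcome for every game $X$, where $+$ is the disjunctive sum. Let $*=\{0\mid 0\}$, $\uparrow=\{0\mid *\}$, $\downarrow=\{*\mid 0\}$, $\uparrow\!*=\uparrow+*$, $\downarrow\!*=\downarrow+*$, and let $k\cdot G$ denote the disjunctive sum of $k$ copies of $G$. Let $\bullet^m$ and $\circ^m$ denote $m$ consecutive black and white stones. Theorem. Let $s$ be a single BIPASS strip (all of whose stones are alive) and let $k\ge 0$ be an integer. Then $$s\equiv k\cdot(\uparrow\!*)+* \quad\Longleftrightarrow\quad s=\bullet\,\circ^{n+k}\,\bullet^{n}\,\circ\ \text{ for some integer } n\ge 0,$$ and $$s\equiv k\cdot(\downarrow\!*)+* \quad\Longleftrightarrow\quad s=\bullet\,\circ^{n}\,\bullet^{n+k}\,\circ\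 \text{ for some integer } n\ge 0,$$ where equality on the right-hand sides is literal equality of strips. -/

import Mathlib

namespace Bipass

/-! ### Normal-play combinatorial games -/

/-- A two-player (partizan) combinatorial game, given by the families of its Left options and of
its Right options. -/
inductive Game : Type 1
  | mk (L R : Type) (l : L → Game) (r : R → Game) : Game

namespace Game

/-- The game `0 = {∣}` without any options. -/
def zero : Game := mk Empty Empty Empty.elim Empty.elim

/-- The game `* = {0 ∣ 0}`. -/
def star : Game := mk Unit Unit (fun _ => zero) (fun _ => zero)

/-- The game `↑ = {0 ∣ *}`. -/
def up : Game := mk Unit Unit (fun _ => zero) (fun _ => star)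

/-- The game `↓ = {* ∣ 0}`. -/
def down : Game := mk Unit Unit (fun _ => star) (fun _ => zero)

/-- The disjunctive sum: the player to move makes a move in exactly one of the two components,
`G + H = {Gᴸ + H, G + Hᴸ ∣ Gᴿ + H, G + Hᴿ}`. -/
noncomputable def add (G : Game) : Game → Game :=
  Game.rec (motive := fun _ => Game → Game)
    (fun L R _ _ ihL ihR H =>
      Game.rec (motive := fun _ => Game)
        (fun L' R' l' r' ihL' ihR' =>
          mk (L ⊕ L') (R ⊕ R')
            (Sum.elim (fun i => ihL i (mk L' R' l' r')) ihL')
            (Sum.elim (fun j => ihR j (mk L' R' l' r')) ihR'))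
        H)
    G

theorem add_mk (L R L' R' : Type) (l : L → Game) (r : R → Game) (l' : L' → Game)
    (r' : R' → Game) :
    add (mk L R l r) (mk L' R' l' r') =
      mk (L ⊕ L') (R ⊕ R')
        (Sum.elim (fun i => add (l i) (mk L' R' l' r')) (fun i => add (mk L R l r) (l' i)))
        (Sum.elim (fun j => add (r j) (mk L' R' l' r')) (fun j => add (mk L R l r) (r' j))) :=
  rfl

/-- The disjunctive sum of `k` copies of `G`. -/
noncomputable def copies : ℕ → Game → Game
  | 0, _ => zero
  | k + 1, G => add (copies k G) G

/-- The game `↑* = ↑ + *`. -/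
noncomputable def upStar : Game := add up star

/-- The game `↓* = ↓ + *`. -/
noncomputable def downStar : Game := add down star

mutual

/-- Left, moving first, wins `G` under normal play (a player who cannot move loses): she has a
move to a position which Right, moving first, does not win. -/
def LeftWinsFirst : Game → Prop
  | mk L _ l _ => ∃ i : L, ¬ RightWinsFirst (l i)

/-- Right, moving first, wins `G` under normal play. -/
def RightWinsFirst : Game → Prop
  | mk _ R _ r => ∃ j : R, ¬ LeftWinsFirst (r j)

end

/-- `G` and `H` have the same outcome: for either choice of the starting player the same player
wins. -/
def SameOutcome (G H : Game) : Prop :=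
  (LeftWinsFirst G ↔ LeftWinsFirst H) ∧ (RightWinsFirst G ↔ RightWinsFirst H)

/-- Equality of game values: `G` and `H` can be exchanged for one another in every disjunctive sum
without changing the outcome. -/
def ValueEq (G H : Game) : Prop :=
  ∀ X : Game, SameOutcome (add G X) (add H X)

end Game

/-! ### Strips and moves -/

/-- The stones: Left plays black, Right plays white. -/
inductive Stone : Type
  | black : Stone
  | white : Stone
deriving DecidableEq

open Stone

/-- All stones of the row `s` (listed from left to right) are alive: every black stone has a white
stone somewhere to its right, and every white stone has a black stone somewhere to its left.
The single strips of the game are the rows all of whose stones are alive. -/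
def AllAlive (s : List Stone) : Prop :=
  (∀ u v : List Stone, s = u ++ black :: v → white ∈ v) ∧
    (∀ u v : List Stone, s = u ++ white :: v → black ∈ u)

/-- Remove the dead stones of a row. The dead stones are the white stones without a black stone to
their left, which are the leading white stones, and the black stones without a white stone to
their right, which are the trailing black stones. -/
def removeDead (s : List Stone) : List Stone :=
  (s.dropWhile (· = white)).rdropWhile (· = black)

/-- A Left move: interchange a black stone and a white stone to its right such that no black stone
lies between them; then the stones that have died are removed. -/
inductive LeftMove : List Stone → List Stone → Prop
  | swap (u m v : List Stone) (hm : black ∉ m) :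
      LeftMove (u ++ black :: (m ++ white :: v)) (removeDead (u ++ white :: (m ++ black :: v)))

/-- A Right move: interchange a black stone and a white stone to its right such that no white stone
lies between them; then the stones that have died are removed. -/
inductive RightMove : List Stone → List Stone → Prop
  | swap (u m v : List Stone) (hm : white ∉ m) :
      RightMove (u ++ black :: (m ++ white :: v)) (removeDead (u ++ white :: (m ++ black :: v)))

/-- The number of pairs consisting of a black stone and a white stone to its right; it decreases
with every move, so that play ends. -/
def pairs : List Stone → ℕ
  | [] => 0
  | black :: s => s.count white + pairs s
  | white :: s => pairs s

theorem pairs_append (s t : List Stone) :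
    pairs (s ++ t) = pairs s + s.count black * t.count white + pairs t := by
  induction s with
  | nil => simp [pairs]
  | cons a s ih => cases a <;> simp [pairs, ih] <;> ring

theorem pairs_swap (u m v : List Stone) :
    pairs (u ++ white :: (m ++ black :: v)) < pairs (u ++ black :: (m ++ white :: v)) := by
  simp [pairs, pairs_append]
  ring_nf
  omega

theorem pairs_le_of_sublist {s t : List Stone} (h : s.Sublist t) : pairs s ≤ pairs t := by
  induction h with
  | slnil => simp
  | cons a h ih => cases a <;> simp [pairs] <;> omega
  | cons_cons a h ih =>
    have := h.count_le white
    cases a <;> simp [pairs] <;> omega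

theorem pairs_removeDead_le (s : List Stone) : pairs (removeDead s) ≤ pairs s :=
  pairs_le_of_sublist
    ((List.rdropWhile_prefix _ _).sublist.trans (List.dropWhile_suffix _).sublist)

theorem LeftMove.pairs_lt {s t : List Stone} (h : LeftMove s t) : pairs t < pairs s := by
  cases h
  exact (pairs_removeDead_le _).trans_lt (pairs_swap _ _ _)

theorem RightMove.pairs_lt {s t : List Stone} (h : RightMove s t) : pairs t < pairs s := by
  cases h
  exact (pairs_removeDead_le _).trans_lt (pairs_swap _ _ _)

/-- The strip `s` as a combinatorial game: the Left (Right) options are the games of the strips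
that can be reached from `s` by a Left (Right) move. -/
noncomputable def game (s : List Stone) : Game :=
  Game.mk {t : List Stone // LeftMove s t} {t : List Stone // RightMove s t}
    (fun t => game t.1) (fun t => game t.1)
termination_by pairs s
decreasing_by
  · exact t.2.pairs_lt
  · exact t.2.pairs_lt

end Bipass

-- Write `multiple k` for the canonical form of `k · ↑* + *`, for any integer `k`: it is `*` for `k
-- = 0` and `{0 ∣ multiple (k - 1)}` for `k > 0`, and `multiple (-k)` is the negative of `multiple
-- k`. The invariant that governs strips is the weight, the number of white stones minus the number
-- of black ones. A Right move lowers it by at most one, because at most one white stone dies, and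
-- Left can raise it by one whenever there are two black stones, by letting the last of them die.
--
-- By induction along play, a strip of weight at least `j + 1` is greater than or fuzzy with
-- `multiple j`, and one of weight at least `j + 2` is at least `multiple j`
-- (`multiple_lf_and_le_game`). Reading a strip backwards with exchanged colours negates both its
-- value and its weight, so a strip equal to `multiple k` has weight exactly `k`.
--
-- Among strips of weight `k`, the strips `•∘ᵃ•ᵇ∘` with `a - b = k` do have this value
-- (`valueEq_game_blockStrip`): Left answers the death of a white stone by that of a black one, and
-- the reverse inequality follows by symmetry. Any other strip with at least two black stones has at
-- least two white stones behind its second black stone. If its weight is nonnegative, Left wins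
-- moving first on the strip minus `multiple k`, so the values differ (`multiple_weight_lf_game`).
-- The statement about `↓*` is the mirror image of the one about `↑*`.

namespace Bipass

namespace Game

/-! ### Options -/

/-- The set of Left options of a game. -/
def leftOptions : Game → Set Game
  | mk _ _ l _ => Set.range l

/-- The set of Right options of a game. -/
def rightOptions : Game → Set Game
  | mk _ _ _ r => Set.range r

theorem options_induction {P : Game → Prop}
    (h : ∀ G : Game, (∀ G' ∈ G.leftOptions, P G') → (∀ G' ∈ G.rightOptions, P G') → P G)
    (G : Game) : P G := by
  induction G with
  | mk L R l r ihl ihr =>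
    refine h _ ?_ ?_
    · rintro _ ⟨i, rfl⟩; exact ihl i
    · rintro _ ⟨i, rfl⟩; exact ihr i

theorem leftWinsFirst_iff {G : Game} :
    LeftWinsFirst G ↔ ∃ G' ∈ G.leftOptions, ¬ RightWinsFirst G' := by
  cases G; simp [LeftWinsFirst, leftOptions]

theorem rightWinsFirst_iff {G : Game} :
    RightWinsFirst G ↔ ∃ G' ∈ G.rightOptions, ¬ LeftWinsFirst G' := by
  cases G; simp [RightWinsFirst, rightOptions]

@[simp] theorem mem_leftOptions_add {G H K : Game} :
    K ∈ (add G H).leftOptions ↔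
      (∃ G' ∈ G.leftOptions, K = add G' H) ∨ ∃ H' ∈ H.leftOptions, K = add G H' := by
  cases G; cases H
  simp [add_mk, leftOptions, eq_comm]

@[simp] theorem mem_rightOptions_add {G H K : Game} :
    K ∈ (add G H).rightOptions ↔
      (∃ G' ∈ G.rightOptions, K = add G' H) ∨ ∃ H' ∈ H.rightOptions, K = add G H' := by
  cases G; cases H
  simp [add_mk, rightOptions, eq_comm]

@[simp] theorem leftOptions_zero : zero.leftOptions = ∅ := Set.range_eq_empty _

@[simp] theorem rightOptions_zero : zero.rightOptions = ∅ := Set.range_eq_empty _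

@[simp] theorem leftOptions_star : star.leftOptions = {zero} := by simp [star, leftOptions]

@[simp] theorem rightOptions_star : star.rightOptions = {zero} := by simp [star, rightOptions]

@[simp] theorem leftOptions_up : up.leftOptions = {zero} := by simp [up, leftOptions]

@[simp] theorem rightOptions_up : up.rightOptions = {star} := by simp [up, rightOptions]

/-! ### The option-wise order -/

mutual

/-- `G ≤ H`: Left, moving second, wins `H - G`. -/
inductive Le : Game → Game → Prop
  | intro {G H : Game} (hl : ∀ G' ∈ G.leftOptions, Lf G' H)
      (hr : ∀ H' ∈ H.rightOptions, Lf G H') : Le G H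

/-- `G` is less than or fuzzy with `H`: Left, moving first, wins `H - G`. -/
inductive Lf : Game → Game → Prop
  | left {G H : Game} (H' : Game) (h : H' ∈ H.leftOptions) (hle : Le G H') : Lf G H
  | right {G H : Game} (G' : Game) (h : G' ∈ G.rightOptions) (hle : Le G' H) : Lf G H

end

theorem le_iff {G H : Game} :
    Le G H ↔ (∀ G' ∈ G.leftOptions, Lf G' H) ∧ ∀ H' ∈ H.rightOptions, Lf G H' :=
  ⟨fun | .intro hl hr => ⟨hl, hr⟩, fun h => .intro h.1 h.2⟩

theorem lf_iff {G H : Game} :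
    Lf G H ↔ (∃ H' ∈ H.leftOptions, Le G H') ∨ ∃ G' ∈ G.rightOptions, Le G' H :=
  ⟨fun | .left H' h hle => .inl ⟨H', h, hle⟩
       | .right G' h hle => .inr ⟨G', h, hle⟩,
    fun | .inl ⟨H', h, hle⟩ => .left H' h hle
        | .inr ⟨G', h, hle⟩ => .right G' h hle⟩

/-- A joint induction over two games. -/
theorem options_induction₂ {P : Game → Game → Prop}
    (h : ∀ G H : Game, (∀ G' ∈ G.leftOptions, P G' H) → (∀ G' ∈ G.rightOptions, P G' H) →
      (∀ H' ∈ H.leftOptions, P G H') → (∀ H' ∈ H.rightOptions, P G H') → P G H)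
    (G H : Game) : P G H := by
  induction G using options_induction generalizing H with
  | h G ihl ihr =>
    induction H using options_induction with
    | h H jhl jhr =>
      exact h G H (fun G' hG => ihl G' hG H) (fun G' hG => ihr G' hG H) jhl jhr

/-- A joint induction over three games. -/
theorem options_induction₃ {P : Game → Game → Game → Prop}
    (h : ∀ G H K : Game, (∀ G' ∈ G.leftOptions, P G' H K) → (∀ G' ∈ G.rightOptions, P G' H K) →
      (∀ H' ∈ H.leftOptions, P G H' K) → (∀ H' ∈ H.rightOptions, P G H' K) →
      (∀ K' ∈ K.leftOptions, P G H K') → (∀ K' ∈ K.rightOptions, P G H K') → P G H K)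
    (G H K : Game) : P G H K := by
  induction G using options_induction generalizing H K with
  | h G ihl ihr =>
    induction H, K using options_induction₂ with
    | h H K jhl jhr khl khr =>
      exact h G H K (fun G' hG => ihl G' hG H K) (fun G' hG => ihr G' hG H K) jhl jhr khl khr

theorem le_add_comm (G H : Game) : Le (add G H) (add H G) := by
  induction G, H using options_induction₂ with
  | h G H ihl ihr jhl jhr =>
    refine .intro ?_ ?_
    · intro K hK
      rcases mem_leftOptions_add.1 hK with ⟨G', h, rfl⟩ | ⟨H', h, rfl⟩
      · exact .left (add H G') (by simpa using .inr ⟨G', h, rfl⟩) (ihl G' h)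
      · exact .left (add H' G) (by simpa using .inl ⟨H', h, rfl⟩) (jhl H' h)
    · intro K hK
      rcases mem_rightOptions_add.1 hK with ⟨H', h, rfl⟩ | ⟨G', h, rfl⟩
      · exact .right (add G H') (by simpa using .inr ⟨H', h, rfl⟩) (jhr H' h)
      · exact .right (add G' H) (by simpa using .inl ⟨G', h, rfl⟩) (ihr G' h)

theorem le_add_assoc (G H K : Game) :
    Le (add (add G H) K) (add G (add H K)) ∧ Le (add G (add H K)) (add (add G H) K) := by
  induction G, H, K using options_induction₃ with
  | h G H K g1 g2 h1 h2 k1 k2 =>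
    refine ⟨.intro ?_ ?_, .intro ?_ ?_⟩ <;> intro M hM <;>
      simp only [mem_leftOptions_add, mem_rightOptions_add] at hM
    · rcases hM with ⟨_, ⟨G', h, rfl⟩ | ⟨H', h, rfl⟩, rfl⟩ | ⟨K', h, rfl⟩
      · exact .left _ (mem_leftOptions_add.2 (.inl ⟨G', h, rfl⟩)) (g1 G' h).1
      · exact .left _ (mem_leftOptions_add.2 (.inr ⟨_, mem_leftOptions_add.2
          (.inl ⟨H', h, rfl⟩), rfl⟩)) (h1 H' h).1
      · exact .left _ (mem_leftOptions_add.2 (.inr ⟨_, mem_leftOptions_add.2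
          (.inr ⟨K', h, rfl⟩), rfl⟩)) (k1 K' h).1
    · rcases hM with ⟨G', h, rfl⟩ | ⟨_, ⟨H', h, rfl⟩ | ⟨K', h, rfl⟩, rfl⟩
      · exact .right _ (mem_rightOptions_add.2 (.inl ⟨_, mem_rightOptions_add.2
          (.inl ⟨G', h, rfl⟩), rfl⟩)) (g2 G' h).1
      · exact .right _ (mem_rightOptions_add.2 (.inl ⟨_, mem_rightOptions_add.2
          (.inr ⟨H', h, rfl⟩), rfl⟩)) (h2 H' h).1
      · exact .right _ (mem_rightOptions_add.2 (.inr ⟨K', h, rfl⟩)) (k2 K' h).1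
    · rcases hM with ⟨G', h, rfl⟩ | ⟨_, ⟨H', h, rfl⟩ | ⟨K', h, rfl⟩, rfl⟩
      · exact .left _ (mem_leftOptions_add.2 (.inl ⟨_, mem_leftOptions_add.2
          (.inl ⟨G', h, rfl⟩), rfl⟩)) (g1 G' h).2
      · exact .left _ (mem_leftOptions_add.2 (.inl ⟨_, mem_leftOptions_add.2
          (.inr ⟨H', h, rfl⟩), rfl⟩)) (h1 H' h).2
      · exact .left _ (mem_leftOptions_add.2 (.inr ⟨K', h, rfl⟩)) (k1 K' h).2
    · rcases hM with ⟨_, ⟨G', h, rfl⟩ | ⟨H', h, rfl⟩, rfl⟩ | ⟨K', h, rfl⟩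
      · exact .right _ (mem_rightOptions_add.2 (.inl ⟨G', h, rfl⟩)) (g2 G' h).2
      · exact .right _ (mem_rightOptions_add.2 (.inr ⟨_, mem_rightOptions_add.2
          (.inl ⟨H', h, rfl⟩), rfl⟩)) (h2 H' h).2
      · exact .right _ (mem_rightOptions_add.2 (.inr ⟨_, mem_rightOptions_add.2
          (.inr ⟨K', h, rfl⟩), rfl⟩)) (k2 K' h).2

theorem le_add_zero (G : Game) : Le (add G zero) G ∧ Le G (add G zero) := by
  induction G using options_induction with
  | h G ihl ihr =>
    refine ⟨.intro ?_ ?_, .intro ?_ ?_⟩ <;> intro M hM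
    · obtain ⟨G', h, rfl⟩ : ∃ G' ∈ G.leftOptions, M = add G' zero := by simpa using hM
      exact .left G' h (ihl G' h).1
    · exact .right (add M zero) (by simpa using ⟨M, hM, rfl⟩) (ihr M hM).1
    · exact .left (add M zero) (by simpa using ⟨M, hM, rfl⟩) (ihl M hM).2
    · obtain ⟨G', h, rfl⟩ : ∃ G' ∈ G.rightOptions, M = add G' zero := by simpa using hM
      exact .right G' h (ihr G' h).2

/-! ### Outcomes of sums -/

/-- Left carries her strategy for `G + X` over to `H + X`: moves in `X` are copied, moves in `G` or
`H` are translated by the order. The three claims record who is to move and which relation currently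
holds, so they need one joint induction. -/
theorem outcome_add_of_le (G H X : Game) :
    (Le G H → ¬ RightWinsFirst (add G X) → ¬ RightWinsFirst (add H X)) ∧
      (Lf G H → ¬ RightWinsFirst (add G X) → LeftWinsFirst (add H X)) ∧
      (Le G H → LeftWinsFirst (add G X) → LeftWinsFirst (add H X)) := by
  induction G, H, X using options_induction₃ with
  | h G H X g1 g2 h1 h2 x1 x2 =>
    refine ⟨fun hle hG hH => ?_, fun hlf hG => ?_, fun hle hG => ?_⟩
    · obtain ⟨M, hM, hn⟩ := rightWinsFirst_iff.1 hH
      rcases mem_rightOptions_add.1 hM with ⟨H', h, rfl⟩ | ⟨X', h, rfl⟩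
      · exact hn ((h2 H' h).2.1 ((le_iff.1 hle).2 H' h) hG)
      · refine hn ((x2 X' h).2.2 hle ?_)
        by_contra hc
        exact hG (rightWinsFirst_iff.2 ⟨_, mem_rightOptions_add.2 (.inr ⟨X', h, rfl⟩), hc⟩)
    · rcases lf_iff.1 hlf with ⟨H', h, hle⟩ | ⟨G', h, hle⟩
      · exact leftWinsFirst_iff.2 ⟨_, mem_leftOptions_add.2 (.inl ⟨H', h, rfl⟩),
          (h1 H' h).1 hle hG⟩
      · refine (g2 G' h).2.2 hle ?_
        by_contra hc
        exact hG (rightWinsFirst_iff.2 ⟨_, mem_rightOptions_add.2 (.inl ⟨G', h, rfl⟩), hc⟩)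
    · obtain ⟨M, hM, hn⟩ := leftWinsFirst_iff.1 hG
      rcases mem_leftOptions_add.1 hM with ⟨G', h, rfl⟩ | ⟨X', h, rfl⟩
      · exact (g1 G' h).2.1 ((le_iff.1 hle).1 G' h) hn
      · exact leftWinsFirst_iff.2 ⟨_, mem_leftOptions_add.2 (.inr ⟨X', h, rfl⟩),
          (x1 X' h).1 hle hn⟩

/-- The preorder on games given by outcomes of sums. -/
def OutcomeLe (G H : Game) : Prop :=
  ∀ X : Game, (LeftWinsFirst (add G X) → LeftWinsFirst (add H X)) ∧
    (RightWinsFirst (add H X) → RightWinsFirst (add G X))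

theorem Le.outcomeLe {G H : Game} (h : Le G H) : OutcomeLe G H := fun X =>
  ⟨(outcome_add_of_le G H X).2.2 h, fun h' => by
    by_contra hc
    exact (outcome_add_of_le G H X).1 h hc h'⟩

theorem OutcomeLe.trans {G H K : Game} (h : OutcomeLe G H) (h' : OutcomeLe H K) :
    OutcomeLe G K := fun X =>
  ⟨fun hX => (h' X).1 ((h X).1 hX), fun hX => (h X).2 ((h' X).2 hX)⟩

theorem valueEq_iff_outcomeLe {G H : Game} : ValueEq G H ↔ OutcomeLe G H ∧ OutcomeLe H G := by
  refine ⟨fun h => ⟨fun X => ⟨(h X).1.1, (h X).2.2⟩, fun X => ⟨(h X).1.2, (h X).2.1⟩⟩,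
    fun h X => ⟨⟨(h.1 X).1, (h.2 X).1⟩, ⟨(h.2 X).2, (h.1 X).2⟩⟩⟩

theorem ValueEq.symm {G H : Game} (h : ValueEq G H) : ValueEq H G := fun X =>
  ⟨(h X).1.symm, (h X).2.symm⟩

theorem ValueEq.trans {G H K : Game} (h : ValueEq G H) (h' : ValueEq H K) : ValueEq G K :=
  fun X => ⟨(h X).1.trans (h' X).1, (h X).2.trans (h' X).2⟩

theorem Le.valueEq {G H : Game} (h : Le G H) (h' : Le H G) : ValueEq G H :=
  valueEq_iff_outcomeLe.2 ⟨h.outcomeLe, h'.outcomeLe⟩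

theorem ValueEq.sameOutcome {G H : Game} (h : ValueEq G H) : SameOutcome G H := by
  have key : ∀ G : Game, (LeftWinsFirst (add G zero) ↔ LeftWinsFirst G) ∧
      (RightWinsFirst (add G zero) ↔ RightWinsFirst G) := by
    intro G
    induction G using options_induction with
    | h G ihl ihr =>
      rw [leftWinsFirst_iff, rightWinsFirst_iff, leftWinsFirst_iff, rightWinsFirst_iff]
      refine ⟨⟨?_, ?_⟩, ⟨?_, ?_⟩⟩
      · rintro ⟨M, hM, hn⟩
        obtain ⟨G', h, rfl⟩ : ∃ G' ∈ G.leftOptions, M = add G' zero := by simpa using hM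
        exact ⟨G', h, fun h' => hn ((ihl G' h).2.2 h')⟩
      · rintro ⟨G', h, hn⟩
        exact ⟨add G' zero, by simpa using ⟨G', h, rfl⟩, fun h' => hn ((ihl G' h).2.1 h')⟩
      · rintro ⟨M, hM, hn⟩
        obtain ⟨G', h, rfl⟩ : ∃ G' ∈ G.rightOptions, M = add G' zero := by simpa using hM
        exact ⟨G', h, fun h' => hn ((ihr G' h).1.2 h')⟩
      · rintro ⟨G', h, hn⟩
        exact ⟨add G' zero, by simpa using ⟨G', h, rfl⟩, fun h' => hn ((ihr G' h).1.1 h')⟩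
  exact ⟨(key G).1.symm.trans ((h zero).1.trans (key H).1),
    (key G).2.symm.trans ((h zero).2.trans (key H).2)⟩

theorem valueEq_add_comm (G H : Game) : ValueEq (add G H) (add H G) :=
  (le_add_comm G H).valueEq (le_add_comm H G)

theorem valueEq_add_assoc (G H K : Game) : ValueEq (add (add G H) K) (add G (add H K)) :=
  (le_add_assoc G H K).1.valueEq (le_add_assoc G H K).2

/-- After regrouping, the extra summand `K` becomes part of the test game. -/
theorem ValueEq.add_right {G H : Game} (h : ValueEq G H) (K : Game) :
    ValueEq (add G K) (add H K) := fun X => by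
  have h1 := (valueEq_add_assoc G K X).sameOutcome
  have h2 := (valueEq_add_assoc H K X).sameOutcome
  have h3 := h (add K X)
  exact ⟨h1.1.trans (h3.1.trans h2.1.symm), h1.2.trans (h3.2.trans h2.2.symm)⟩

theorem ValueEq.add_left {G H : Game} (h : ValueEq G H) (K : Game) :
    ValueEq (add K G) (add K H) :=
  (valueEq_add_comm K G).trans ((h.add_right K).trans (valueEq_add_comm H K))

/-! ### Negatives -/

/-- The negative of a game: the roles of the players are interchanged. -/
def neg : Game → Game
  | mk L R l r => mk R L (fun j => neg (r j)) (fun i => neg (l i))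

@[simp] theorem leftOptions_neg (G : Game) : (neg G).leftOptions = neg '' G.rightOptions := by
  cases G; simp [neg, leftOptions, rightOptions, ← Set.range_comp, Function.comp_def]

@[simp] theorem rightOptions_neg (G : Game) : (neg G).rightOptions = neg '' G.leftOptions := by
  cases G; simp [neg, leftOptions, rightOptions, ← Set.range_comp, Function.comp_def]

@[simp] theorem neg_neg (G : Game) : neg (neg G) = G := by
  induction G with
  | mk L R l r ihl ihr => simp [neg, ihl, ihr]

@[simp] theorem neg_zero : neg zero = zero := by
  simp only [zero, neg]
  congr 1 <;> exact funext fun x => x.elim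

@[simp] theorem neg_star : neg star = star := by
  simp [star, neg]

@[simp] theorem neg_down : neg down = up := by
  simp [down, up, neg]

@[simp] theorem neg_add (G H : Game) : neg (add G H) = add (neg G) (neg H) := by
  induction G generalizing H with
  | mk L R l r ihl ihr =>
    induction H with
    | mk L' R' l' r' jhl jhr =>
      simp only [add_mk, neg]
      congr 1 <;> funext x <;> rcases x with x | x
      · simp only [Sum.elim_inl]; rw [ihr]; simp [neg]
      · simp only [Sum.elim_inr]; rw [jhr]; simp [neg]
      · simp only [Sum.elim_inl]; rw [ihl]; simp [neg]
      · simp only [Sum.elim_inr]; rw [jhl]; simp [neg]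

theorem winsFirst_neg (G : Game) :
    (LeftWinsFirst (neg G) ↔ RightWinsFirst G) ∧ (RightWinsFirst (neg G) ↔ LeftWinsFirst G) := by
  induction G with
  | mk L R l r ihl ihr => simp [neg, LeftWinsFirst, RightWinsFirst, ihl, ihr]

theorem OutcomeLe.neg {G H : Game} (h : OutcomeLe G H) : OutcomeLe (neg H) (neg G) := fun X => by
  have h' := h (Game.neg X)
  have hG := winsFirst_neg (add G (Game.neg X))
  have hH := winsFirst_neg (add H (Game.neg X))
  simp only [neg_add, neg_neg] at hG hH
  exact ⟨fun h1 => hG.1.2 (h'.2 (hH.1.1 h1)), fun h1 => hH.2.2 (h'.1 (hG.2.1 h1))⟩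

theorem ValueEq.neg {G H : Game} (h : ValueEq G H) : ValueEq (neg G) (neg H) := by
  rw [valueEq_iff_outcomeLe] at h ⊢
  exact ⟨h.2.neg, h.1.neg⟩

/-- The second player mirrors every move in the other component. -/
theorem not_winsFirst_add_neg (G : Game) :
    ¬ LeftWinsFirst (add G (neg G)) ∧ ¬ RightWinsFirst (add G (neg G)) := by
  induction G using options_induction with
  | h G ihl ihr =>
    constructor
    · intro h
      obtain ⟨M, hM, hn⟩ := leftWinsFirst_iff.1 h
      rcases mem_leftOptions_add.1 hM with ⟨G', h, rfl⟩ | ⟨H', h, rfl⟩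
      · exact hn (rightWinsFirst_iff.2 ⟨add G' (neg G'),
          mem_rightOptions_add.2 (.inr ⟨neg G', by simpa using ⟨G', h, rfl⟩, rfl⟩), (ihl G' h).1⟩)
      · obtain ⟨G', hG, rfl⟩ : ∃ G' ∈ G.rightOptions, neg G' = H' := by
          simpa using h
        exact hn (rightWinsFirst_iff.2 ⟨add G' (neg G'),
          mem_rightOptions_add.2 (.inl ⟨G', hG, rfl⟩), (ihr G' hG).1⟩)
    · intro h
      obtain ⟨M, hM, hn⟩ := rightWinsFirst_iff.1 h
      rcases mem_rightOptions_add.1 hM with ⟨G', h, rfl⟩ | ⟨H', h, rfl⟩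
      · exact hn (leftWinsFirst_iff.2 ⟨add G' (neg G'),
          mem_leftOptions_add.2 (.inr ⟨neg G', by simpa using ⟨G', h, rfl⟩, rfl⟩), (ihr G' h).2⟩)
      · obtain ⟨G', hG, rfl⟩ : ∃ G' ∈ G.leftOptions, neg G' = H' := by
          simpa using h
        exact hn (leftWinsFirst_iff.2 ⟨add G' (neg G'),
          mem_leftOptions_add.2 (.inl ⟨G', hG, rfl⟩), (ihl G' hG).2⟩)

/-- The test game `neg G` separates the two: Left wins `H - G` moving first, but not `G - G`. All
inequalities of values below come from here. -/
theorem Lf.not_valueEq {G H : Game} (h : Lf G H) : ¬ ValueEq H G := fun he =>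
  (not_winsFirst_add_neg G).1 (((he (Game.neg G)).1).1
    ((outcome_add_of_le G H (Game.neg G)).2.1 h (not_winsFirst_add_neg G).2))

/-! ### The values `k · ↑* + *` -/

/-- The canonical form of `k · ↑* + *` for a natural number `k`. -/
def upMultiple : ℕ → Game
  | 0 => star
  | k + 1 => mk Unit Unit (fun _ => zero) (fun _ => upMultiple k)

/-- The canonical form of `k · ↑* + *` for an integer `k`. -/
def multiple : ℤ → Game
  | Int.ofNat n => upMultiple n
  | Int.negSucc n => neg (upMultiple (n + 1))

theorem neg_multiple (k : ℤ) : neg (multiple k) = multiple (-k) := by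
  rcases k with (_ | n) | n
  · simp [multiple, upMultiple]
  · rfl
  · simp [multiple]
    rfl

theorem leftOptions_multiple_of_nonneg {k : ℤ} (hk : 0 ≤ k) :
    (multiple k).leftOptions = {zero} := by
  obtain ⟨n, rfl⟩ := Int.eq_ofNat_of_zero_le hk
  cases n <;> simp [multiple, upMultiple, leftOptions, star]

theorem rightOptions_multiple_of_pos {k : ℤ} (hk : 0 < k) :
    (multiple k).rightOptions = {multiple (k - 1)} := by
  obtain ⟨n, rfl⟩ := Int.eq_succ_of_zero_lt hk
  have h : (n : ℤ) + 1 - 1 = n := by simp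
  simp only [h]
  exact Set.range_const

theorem rightOptions_multiple_of_nonpos {k : ℤ} (hk : k ≤ 0) :
    (multiple k).rightOptions = {zero} := by
  have h := leftOptions_multiple_of_nonneg (k := -k) (by omega)
  rw [← neg_neg (multiple k), neg_multiple, rightOptions_neg, h]
  simp

theorem leftOptions_multiple_of_neg {k : ℤ} (hk : k < 0) :
    (multiple k).leftOptions = {multiple (k + 1)} := by
  have h := rightOptions_multiple_of_pos (k := -k) (by omega)
  rw [← neg_neg (multiple k), neg_multiple, leftOptions_neg, h]
  simp only [Set.image_singleton, neg_multiple]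
  congr 2
  omega

@[simp] theorem leftOptions_upMultiple (k : ℕ) : (upMultiple k).leftOptions = {zero} := by
  cases k <;> simp [upMultiple, leftOptions, star]

@[simp] theorem rightOptions_upMultiple_zero : (upMultiple 0).rightOptions = {zero} := by
  simp [upMultiple]

@[simp] theorem rightOptions_upMultiple_succ (k : ℕ) :
    (upMultiple (k + 1)).rightOptions = {upMultiple k} := by
  simp [upMultiple, rightOptions]

/-- The canonical form `{0, * ∣ 0}` of `↑*`. -/
def upStarForm : Game := mk Bool Unit (fun b => bif b then zero else star) (fun _ => zero)

@[simp] theorem leftOptions_upStarForm : upStarForm.leftOptions = {zero, star} := by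
  ext G; simp [upStarForm, leftOptions, or_comm]

@[simp] theorem rightOptions_upStarForm : upStarForm.rightOptions = {zero} := by
  simp [upStarForm, rightOptions]

-- Comparisons between the canonical forms

theorem le_zero_add_zero : Le (add zero zero) zero := (le_add_zero zero).1

theorem zero_le_add_zero : Le zero (add zero zero) := (le_add_zero zero).2

theorem zero_le_star_add_star : Le zero (add star star) ∧ Le (add star star) zero := by
  refine ⟨.intro (by simp) ?_, .intro ?_ (by simp)⟩ <;>
    simp only [mem_leftOptions_add, mem_rightOptions_add, leftOptions_star, rightOptions_star,
      Set.mem_singleton_iff, exists_eq_left] <;>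
    rintro M (rfl | rfl)
  · exact .left (add zero zero) (by simp) zero_le_add_zero
  · exact .left (add zero zero) (by simp) zero_le_add_zero
  · exact .right (add zero zero) (by simp) le_zero_add_zero
  · exact .right (add zero zero) (by simp) le_zero_add_zero

theorem le_upMultiple_of_le_zero {G : Game} (hl : G.leftOptions = ∅) (h : Le G zero) (k : ℕ) :
    Lf G (upMultiple k) ∧ Le G (upMultiple (k + 1)) := by
  have h1 : ∀ k, Lf G (upMultiple k) := fun k => .left zero (by simp) h
  exact ⟨h1 k, .intro (by simp [hl]) (by simpa using h1 k)⟩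

theorem le_zero_add (G : Game) : Le (add zero G) G ∧ Le G (add zero G) := by
  induction G using options_induction with
  | h G ihl ihr =>
    refine ⟨.intro ?_ ?_, .intro ?_ ?_⟩ <;> intro M hM
    · obtain ⟨G', h, rfl⟩ : ∃ G' ∈ G.leftOptions, M = add zero G' := by simpa using hM
      exact .left G' h (ihl G' h).1
    · exact .right (add zero M) (by simpa using ⟨M, hM, rfl⟩) (ihr M hM).1
    · exact .left (add zero M) (by simpa using ⟨M, hM, rfl⟩) (ihl M hM).2
    · obtain ⟨G', h, rfl⟩ : ∃ G' ∈ G.rightOptions, M = add zero G' := by simpa using hM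
      exact .right G' h (ihr G' h).2

theorem zero_le_up_add_zero : Le zero (add up zero) := by
  refine .intro (by simp) ?_
  simp only [mem_rightOptions_add, rightOptions_up, rightOptions_zero]
  rintro M (⟨_, rfl, rfl⟩ | ⟨_, h, _⟩)
  · exact .left (add zero zero) (by simp) zero_le_add_zero
  · exact h.elim

theorem valueEq_upStar : ValueEq upStar upStarForm := by
  unfold upStar
  refine Le.valueEq (.intro ?_ ?_) (.intro ?_ ?_)
  · simp only [mem_leftOptions_add, leftOptions_up, leftOptions_star, Set.mem_singleton_iff,
      exists_eq_left]
    rintro M (rfl | rfl)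
    · exact .left star (by simp) (le_zero_add star).1
    · refine .right (add star zero) (by simp) (.intro ?_ ?_)
      · simpa using .left zero (by simp) le_zero_add_zero
      · simpa using .right (add zero zero) (by simp) le_zero_add_zero
  · simpa using .right (add star star) (by simp) zero_le_star_add_star.2
  · simp only [leftOptions_upStarForm, Set.mem_insert_iff, Set.mem_singleton_iff]
    rintro M (rfl | rfl)
    · exact .left (add up zero) (by simp) zero_le_up_add_zero
    · exact .left (add zero star) (by simp) (le_zero_add star).2
  · simp only [mem_rightOptions_add, rightOptions_up, rightOptions_star, Set.mem_singleton_iff,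
      exists_eq_left]
    rintro M (rfl | rfl)
    · exact .right zero (by simp) zero_le_star_add_star.1
    · exact .right zero (by simp) zero_le_up_add_zero

/-- The difference is `(j - i) · ↑*`, where `↑*` is fuzzy with `0` and `2 · ↑*` is positive; hence
the thresholds one and two. The summand `zero` is what remains after a move of `upStarForm` to `0`.
-/
theorem upMultiple_add_zero_le (i j : ℕ) :
    (i + 1 ≤ j → Lf (add (upMultiple i) zero) (upMultiple j)) ∧
      (i + 2 ≤ j → Le (add (upMultiple i) zero) (upMultiple j)) := by
  induction i generalizing j with
  | zero =>
    have h1 : ∀ j, 1 ≤ j → Lf (add (upMultiple 0) zero) (upMultiple j) := by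
      intro j hj
      obtain ⟨j, rfl⟩ := Nat.exists_eq_add_of_le' hj
      exact .right (add zero zero) (by simp)
        (le_upMultiple_of_le_zero (by ext; simp) le_zero_add_zero j).2
    refine ⟨h1 j, fun hj => ?_⟩
    obtain ⟨j, rfl⟩ := Nat.exists_eq_add_of_le' hj
    refine .intro ?_ ?_
    · simpa using .left zero (by simp) le_zero_add_zero
    · simpa using h1 (j + 1) (by omega)
  | succ i ih =>
    have h1 : ∀ j, i + 2 ≤ j → Lf (add (upMultiple (i + 1)) zero) (upMultiple j) :=
      fun j hj => .right (add (upMultiple i) zero) (by simp) ((ih j).2 hj)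
    refine ⟨h1 j, fun hj => ?_⟩
    obtain ⟨j, rfl⟩ := Nat.exists_eq_add_of_le' (show 1 ≤ j by omega)
    refine .intro ?_ ?_
    · simpa using .left zero (by simp) le_zero_add_zero
    · simpa using h1 j (by omega)

/-- The extra `*` lowers both thresholds by one: the difference `j - i = 0` leaves `*`, fuzzy with
`0`, and `j - i = 1` leaves `↑`, which is positive. -/
theorem upMultiple_add_star_le (i j : ℕ) :
    (i ≤ j → Lf (add (upMultiple i) star) (upMultiple j)) ∧
      (i + 1 ≤ j → Le (add (upMultiple i) star) (upMultiple j)) := by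
  have step : ∀ i : ℕ, (∀ j, i ≤ j → Lf (add (upMultiple i) star) (upMultiple j)) →
      ∀ j, i + 1 ≤ j → Le (add (upMultiple i) star) (upMultiple j) := by
    intro i h1 j hj
    obtain ⟨j, rfl⟩ := Nat.exists_eq_add_of_le' (show 1 ≤ j by omega)
    refine .intro ?_ (by simpa using h1 j (by omega))
    simp only [mem_leftOptions_add, leftOptions_upMultiple, leftOptions_star,
      Set.mem_singleton_iff, exists_eq_left]
    rintro M (rfl | rfl)
    · exact .right (add zero zero) (by simp)
        (le_upMultiple_of_le_zero (by ext; simp) le_zero_add_zero j).2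
    · exact (upMultiple_add_zero_le i (j + 1)).1 hj
  have base : ∀ i, Lf (add (upMultiple i) star) (upMultiple i) := fun i =>
    .right (add (upMultiple i) zero) (by simp) (le_add_zero _).1
  suffices h : ∀ i j : ℕ, i ≤ j → Lf (add (upMultiple i) star) (upMultiple j) from
    ⟨h i j, step i (h i) j⟩
  intro i
  induction i with
  | zero => exact fun j _ => .left zero (by simp) zero_le_star_add_star.2
  | succ i ih =>
    intro j hj
    rcases hj.eq_or_lt with rfl | hj
    · exact base _
    · exact .right (add (upMultiple i) star) (by simp) (step i ih j (by omega))

theorem upMultiple_add_upStarForm_le (k : ℕ) :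
    Le (add (upMultiple k) upStarForm) (upMultiple (k + 1)) := by
  refine .intro ?_ ?_
  · simp only [mem_leftOptions_add, leftOptions_upMultiple, leftOptions_upStarForm,
      Set.mem_singleton_iff, Set.mem_insert_iff, exists_eq_left, exists_eq_or_imp]
    rintro M (rfl | rfl | rfl)
    · exact .right (add zero zero) (by simp)
        (le_upMultiple_of_le_zero (by ext; simp) le_zero_add_zero k).2
    · exact (upMultiple_add_zero_le k (k + 1)).1 le_rfl
    · exact (upMultiple_add_star_le k (k + 1)).1 (by omega)
  · simpa using .right (add (upMultiple k) zero) (by simp) (le_add_zero _).1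

theorem upMultiple_le_add_upStarForm (k : ℕ) :
    Le (upMultiple (k + 1)) (add (upMultiple k) upStarForm) := by
  induction k with
  | zero =>
    refine .intro ?_ ?_
    -- Here Left needs the option `*` of `upStarForm`: moving to `0` would leave only `*`, which is
    -- not at least `0`.
    · simpa using .left (add star star) (by simp [upMultiple]) zero_le_star_add_star.1
    · simp only [mem_rightOptions_add, rightOptions_upMultiple_zero, rightOptions_upStarForm,
        Set.mem_singleton_iff, exists_eq_left]
      rintro M (rfl | rfl)
      · refine .right star (by simp [upMultiple, rightOptions]) (.intro ?_ ?_)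
        · simpa using .left (add zero zero) (by simp) zero_le_add_zero
        · simpa using .right zero (by simp) zero_le_add_zero
      · exact .right (upMultiple 0) (by simp) (le_add_zero _).2
  | succ k ih =>
    refine .intro ?_ ?_
    · suffices h : Le zero (add (upMultiple (k + 1)) zero) by
        simpa using .left (add (upMultiple (k + 1)) zero) (by simp) h
      refine .intro (by simp) ?_
      simpa using .left (add zero zero) (by simp) zero_le_add_zero
    · simp only [mem_rightOptions_add, rightOptions_upMultiple_succ, rightOptions_upStarForm,
        Set.mem_singleton_iff, exists_eq_left]
      rintro M (rfl | rfl)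
      · exact .right (upMultiple (k + 1)) (by simp) ih
      · exact .right (upMultiple (k + 1)) (by simp) (le_add_zero _).2

/-- Adding one more `↑*` raises the index of the canonical form by one; the lone `*` is moved past
the new summand first. -/
theorem valueEq_multiple (k : ℕ) : ValueEq (add (copies k upStar) star) (multiple k) := by
  change ValueEq _ (upMultiple k)
  induction k with
  | zero => exact (le_zero_add star).1.valueEq (le_zero_add star).2
  | succ k ih =>
    refine (valueEq_add_assoc _ _ _).trans <| ((valueEq_add_comm _ _).add_left _).trans <|
      (valueEq_add_assoc _ _ _).symm.trans <| (ih.add_right _).trans <|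
      (valueEq_upStar.add_left _).trans ?_
    exact (upMultiple_add_upStarForm_le k).valueEq (upMultiple_le_add_upStarForm k)

theorem neg_copies_downStar (k : ℕ) :
    neg (add (copies k downStar) star) = add (copies k upStar) star := by
  have h₀ : neg downStar = upStar := by simp [downStar, upStar]
  have h : neg (copies k downStar) = copies k upStar := by
    induction k with
    | zero => simp [copies]
    | succ k ih => simp [copies, ih, h₀]
  simp [h]

end Game

open Stone

/-! ### Dead stones -/

theorem allAlive_iff {s : List Stone} :
    AllAlive s ↔ s = [] ∨ ∃ m, s = black :: (m ++ [white]) := by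
  constructor
  · rintro ⟨hb, hw⟩
    rcases s with _ | ⟨_ | _, s⟩
    · exact .inl rfl
    · right
      have hs : white ∈ s := hb [] s rfl
      rcases s.eq_nil_or_concat' with rfl | ⟨m, x, rfl⟩
      · simp at hs
      · cases x
        · simpa using hb (black :: m) [] rfl
        · exact ⟨m, rfl⟩
    · simpa using hw [] s rfl
  · rintro (rfl | ⟨m, rfl⟩)
    · exact ⟨by simp, by simp⟩
    · refine ⟨fun u v h => ?_, fun u v h => ?_⟩
      · rcases v.eq_nil_or_concat' with rfl | ⟨v, x, rfl⟩
        · have := congrArg List.getLast? h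
          simp [List.getLast?_cons] at this
        · have := congrArg List.getLast? h
          simp [List.getLast?_cons, List.getLast?_append] at this
          simp [this]
      · rcases u with _ | ⟨x, u⟩
        · simp at h
        · simp at h
          simp [h.1]

theorem allAlive_nil : AllAlive [] := allAlive_iff.2 (.inl rfl)

theorem allAlive_black_append_white (m : List Stone) : AllAlive (black :: (m ++ [white])) :=
  allAlive_iff.2 (.inr ⟨m, rfl⟩)

/-- The living part is determined by any such decomposition, so removals can be computed by
exhibiting one. -/
theorem removeDead_eq {t : List Stone} (ht : AllAlive t) (p q : ℕ) :
    removeDead (List.replicate p white ++ (t ++ List.replicate q black)) = t := by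
  unfold removeDead
  rw [List.dropWhile_append_of_pos (by simp)]
  rcases allAlive_iff.1 ht with rfl | ⟨m, rfl⟩
  · rw [List.nil_append, List.rdropWhile_eq_nil_iff]
    intro x hx
    have := (List.dropWhile_sublist _).subset hx
    simpa using List.eq_of_mem_replicate this
  · rw [List.cons_append, List.dropWhile_cons_of_neg (by simp)]
    have h : (black :: (m ++ [white] ++ List.replicate q black)).reverse =
        List.replicate q black ++ white :: (m.reverse ++ [black]) := by simp
    rw [List.rdropWhile, h, List.dropWhile_append_of_pos (by simp),
      List.dropWhile_cons_of_neg (by simp)]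
    simp

theorem exists_eq_replicate_white_append (s : List Stone) :
    ∃ p l, s = List.replicate p white ++ l ∧ (l = [] ∨ ∃ l', l = black :: l') := by
  induction s with
  | nil => exact ⟨0, [], by simp⟩
  | cons x s ih =>
    cases x
    · exact ⟨0, _, rfl, .inr ⟨s, rfl⟩⟩
    · obtain ⟨p, l, rfl, hl⟩ := ih
      exact ⟨p + 1, l, by simp [List.replicate_succ], hl⟩

theorem exists_eq_append_replicate_black (s : List Stone) :
    ∃ q l, s = l ++ List.replicate q black ∧ (l = [] ∨ ∃ l', l = l' ++ [white]) := by
  induction s using List.reverseRecOn with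
  | nil => exact ⟨0, [], by simp⟩
  | append_singleton s x ih =>
    cases x
    · obtain ⟨q, l, rfl, hl⟩ := ih
      exact ⟨q + 1, l, by simp [List.replicate_succ'], hl⟩
    · exact ⟨0, s ++ [white], by simp, .inr ⟨s, rfl⟩⟩

theorem removeDead_spec (s : List Stone) :
    AllAlive (removeDead s) ∧
      ∃ p q, s = List.replicate p white ++ (removeDead s ++ List.replicate q black) := by
  suffices h : ∃ t, AllAlive t ∧
      ∃ p q, s = List.replicate p white ++ (t ++ List.replicate q black) by
    obtain ⟨t, ht, p, q, rfl⟩ := h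
    rw [removeDead_eq ht]
    exact ⟨ht, p, q, rfl⟩
  obtain ⟨p, l, rfl, hl⟩ := exists_eq_replicate_white_append s
  obtain ⟨q, m, rfl, hm⟩ := exists_eq_append_replicate_black l
  rcases hm with rfl | ⟨m, rfl⟩
  · exact ⟨[], allAlive_nil, p, q, rfl⟩
  · rcases m with _ | ⟨x, m⟩
    · simp at hl
    · obtain rfl : x = black := by simpa using hl
      exact ⟨_, allAlive_black_append_white m, p, q, rfl⟩

/-! ### Moves -/

theorem exists_eq_replicate_of_notMem {x y : Stone} (hxy : x ≠ y) {m : List Stone}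
    (h : x ∉ m) : ∃ n, m = List.replicate n y := by
  refine ⟨m.length, List.eq_replicate_of_mem fun z hz => ?_⟩
  cases x <;> cases y <;> cases z <;> simp_all

theorem replicate_append_cons (n : ℕ) (x : Stone) (l : List Stone) :
    List.replicate n x ++ x :: l = x :: (List.replicate n x ++ l) := by
  induction n with
  | zero => rfl
  | succ n ih => simp [List.replicate_succ, ih]

/-- Only black stones can lie between, so a Right move carries a white stone leftwards over a
nonempty run of black stones, not necessarily a maximal one. -/
theorem rightMove_iff {s t : List Stone} :
    RightMove s t ↔ ∃ u n v, s = u ++ (List.replicate (n + 1) black ++ white :: v) ∧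
      t = removeDead (u ++ white :: (List.replicate (n + 1) black ++ v)) := by
  constructor
  · rintro ⟨u, m, v, hm⟩
    obtain ⟨n, rfl⟩ := exists_eq_replicate_of_notMem (y := black) (by simp) hm
    refine ⟨u, n, v, by simp [List.replicate_succ], ?_⟩
    simp [List.replicate_succ']
  · rintro ⟨u, n, v, rfl, rfl⟩
    have := RightMove.swap u (List.replicate n black) v (by simp)
    simpa [List.replicate_succ, replicate_append_cons] using this

theorem leftMove_iff {s t : List Stone} :
    LeftMove s t ↔ ∃ u n v, s = u ++ black :: (List.replicate (n + 1) white ++ v) ∧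
      t = removeDead (u ++ (List.replicate (n + 1) white ++ black :: v)) := by
  constructor
  · rintro ⟨u, m, v, hm⟩
    obtain ⟨n, rfl⟩ := exists_eq_replicate_of_notMem (y := white) (by simp) hm
    refine ⟨u, n, v, ?_, by simp [List.replicate_succ]⟩
    simp [List.replicate_succ']
  · rintro ⟨u, n, v, rfl, rfl⟩
    have := LeftMove.swap u (List.replicate n white) v (by simp)
    simpa [List.replicate_succ, replicate_append_cons] using this

theorem RightMove.allAlive {s t : List Stone} (h : RightMove s t) : AllAlive t := by
  obtain ⟨u, n, v, rfl, rfl⟩ := rightMove_iff.1 h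
  exact (removeDead_spec _).1

/-! ### Reversal with exchange of colours -/

/-- The other colour. -/
def Stone.flip : Stone → Stone
  | black => white
  | white => black

/-- The row read backwards with the colours exchanged. -/
def flipRow (s : List Stone) : List Stone := (s.map Stone.flip).reverse

@[simp] theorem Stone.flip_flip (x : Stone) : x.flip.flip = x := by cases x <;> rfl

@[simp] theorem flipRow_flipRow (s : List Stone) : flipRow (flipRow s) = s := by
  simp [flipRow, Function.comp_def]

@[simp] theorem flipRow_nil : flipRow [] = [] := rfl

@[simp] theorem flipRow_append (s t : List Stone) : flipRow (s ++ t) = flipRow t ++ flipRow s := by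
  simp [flipRow]

@[simp] theorem flipRow_cons (x : Stone) (s : List Stone) :
    flipRow (x :: s) = flipRow s ++ [x.flip] := by
  simp [flipRow]

@[simp] theorem flipRow_replicate (n : ℕ) (x : Stone) :
    flipRow (List.replicate n x) = List.replicate n x.flip := by
  simp [flipRow]

@[simp] theorem flip_black : black.flip = white := rfl

@[simp] theorem flip_white : white.flip = black := rfl

theorem flipRow_injective : Function.Injective flipRow :=
  Function.LeftInverse.injective flipRow_flipRow

theorem count_flipRow (s : List Stone) :
    (flipRow s).count black = s.count white ∧ (flipRow s).count white = s.count black := by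
  induction s with
  | nil => simp
  | cons x s ih => cases x <;> simp [ih]

theorem AllAlive.flipRow {s : List Stone} (h : AllAlive s) : AllAlive (flipRow s) := by
  rcases allAlive_iff.1 h with rfl | ⟨m, rfl⟩
  · exact allAlive_nil
  · simpa using allAlive_black_append_white (Bipass.flipRow m)

theorem flipRow_removeDead (s : List Stone) : flipRow (removeDead s) = removeDead (flipRow s) := by
  obtain ⟨h, p, q, hs⟩ := removeDead_spec s
  conv_rhs => rw [hs]
  simp [removeDead_eq h.flipRow]

theorem RightMove.flipRow {s t : List Stone} (h : RightMove s t) :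
    LeftMove (flipRow s) (flipRow t) := by
  obtain ⟨u, n, v, rfl, rfl⟩ := rightMove_iff.1 h
  exact leftMove_iff.2 ⟨Bipass.flipRow v, n, Bipass.flipRow u, by simp,
    by simp [flipRow_removeDead]⟩

theorem LeftMove.flipRow {s t : List Stone} (h : LeftMove s t) :
    RightMove (flipRow s) (flipRow t) := by
  obtain ⟨u, n, v, rfl, rfl⟩ := leftMove_iff.1 h
  exact rightMove_iff.2 ⟨Bipass.flipRow v, n, Bipass.flipRow u, by simp,
    by simp [flipRow_removeDead]⟩

/-! ### The game of a strip -/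

open Game

theorem mem_leftOptions_game {s : List Stone} {G : Game} :
    G ∈ (game s).leftOptions ↔ ∃ t, LeftMove s t ∧ G = game t := by
  rw [game]
  simp [leftOptions, eq_comm]

theorem mem_rightOptions_game {s : List Stone} {G : Game} :
    G ∈ (game s).rightOptions ↔ ∃ t, RightMove s t ∧ G = game t := by
  rw [game]
  simp [rightOptions, eq_comm]

/-- `flipRow` turns Left moves into Right moves and back, and commutes with the removal of dead
stones. -/
theorem le_game_flipRow (s : List Stone) :
    Le (neg (game s)) (game (flipRow s)) ∧ Le (game (flipRow s)) (neg (game s)) := by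
  induction h : pairs s using Nat.strong_induction_on generalizing s with
  | _ N ih =>
    subst h
    have ihl : ∀ t, LeftMove s t → _ := fun t ht => ih _ ht.pairs_lt t rfl
    have ihr : ∀ t, RightMove s t → _ := fun t ht => ih _ ht.pairs_lt t rfl
    have fl : ∀ t, LeftMove (flipRow s) t → ∃ t', RightMove s t' ∧ t = flipRow t' :=
      fun t ht => ⟨flipRow t, by simpa using ht.flipRow, by simp⟩
    have fr : ∀ t, RightMove (flipRow s) t → ∃ t', LeftMove s t' ∧ t = flipRow t' :=
      fun t ht => ⟨flipRow t, by simpa using ht.flipRow, by simp⟩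
    refine ⟨.intro ?_ ?_, .intro ?_ ?_⟩ <;> intro M hM <;>
      simp only [leftOptions_neg, rightOptions_neg, Set.mem_image, mem_leftOptions_game,
        mem_rightOptions_game] at hM
    · obtain ⟨_, ⟨t, ht, rfl⟩, rfl⟩ := hM
      exact .left _ (mem_leftOptions_game.2 ⟨_, ht.flipRow, rfl⟩) (ihr t ht).1
    · obtain ⟨t, ht, rfl⟩ := hM
      obtain ⟨t, ht', rfl⟩ := fr t ht
      exact .right (neg (game t)) (by simpa using ⟨_, mem_leftOptions_game.2 ⟨t, ht', rfl⟩, rfl⟩)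
        (ihl t ht').1
    · obtain ⟨t, ht, rfl⟩ := hM
      obtain ⟨t, ht', rfl⟩ := fl t ht
      exact .left (neg (game t)) (by simpa using ⟨_, mem_rightOptions_game.2 ⟨t, ht', rfl⟩, rfl⟩)
        (ihr t ht').2
    · obtain ⟨_, ⟨t, ht, rfl⟩, rfl⟩ := hM
      exact .right _ (mem_rightOptions_game.2 ⟨_, ht.flipRow, rfl⟩) (ihl t ht).2

theorem valueEq_game_flipRow (s : List Stone) : ValueEq (game (flipRow s)) (neg (game s)) :=
  (le_game_flipRow s).2.valueEq (le_game_flipRow s).1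

/-! ### Shapes of strips and their moves -/

/-- The number of white stones minus the number of black stones. -/
def weight (s : List Stone) : ℤ := s.count white - s.count black

/-- The number of white stones behind the first black stone of a row. -/
def whiteAfterBlack (s : List Stone) : ℕ := (s.dropWhile (· = white)).count white

@[simp] theorem whiteAfterBlack_nil : whiteAfterBlack [] = 0 := rfl

@[simp] theorem whiteAfterBlack_white_cons (s : List Stone) :
    whiteAfterBlack (white :: s) = whiteAfterBlack s := by
  simp [whiteAfterBlack]

@[simp] theorem whiteAfterBlack_black_cons (s : List Stone) :
    whiteAfterBlack (black :: s) = s.count white := by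
  simp [whiteAfterBlack]

@[simp] theorem whiteAfterBlack_replicate_white_append (p : ℕ) (s : List Stone) :
    whiteAfterBlack (List.replicate p white ++ s) = whiteAfterBlack s := by
  induction p with
  | zero => rfl
  | succ p ih => simp [List.replicate_succ, ih]

-- Together with invariance under leading white stones, this makes the count insensitive to dead
-- stones.
@[simp] theorem whiteAfterBlack_append_replicate_black (s : List Stone) (q : ℕ) :
    whiteAfterBlack (s ++ List.replicate q black) = whiteAfterBlack s := by
  induction s with
  | nil => cases q <;> simp [List.replicate_succ, List.count_replicate]
  | cons x s ih => cases x <;> simp [ih, List.count_replicate]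

theorem whiteAfterBlack_append {s : List Stone} (h : black ∈ s) (t : List Stone) :
    whiteAfterBlack (s ++ t) = whiteAfterBlack s + t.count white := by
  induction s with
  | nil => simp at h
  | cons x s ih =>
    cases x
    · simp
    · simpa using ih (by simpa using h)

theorem count_black_pos_of_whiteAfterBlack_pos {s : List Stone} (h : 0 < whiteAfterBlack s) :
    0 < s.count black := by
  induction s with
  | nil => simp at h
  | cons x s ih =>
    cases x
    · simp
    · simpa using ih (by simpa using h)

theorem whiteAfterBlack_swap_le (u v : List Stone) (n : ℕ) :
    whiteAfterBlack (u ++ (List.replicate (n + 1) black ++ white :: v)) ≤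
      whiteAfterBlack (u ++ white :: (List.replicate (n + 1) black ++ v)) + 1 := by
  induction u with
  | nil => simp [List.replicate_succ, List.count_replicate]
  | cons x u ih =>
    cases x
    · simp [List.count_replicate]
    · simpa using ih

/-- The number of white stones behind the second black stone of a strip. -/
def whiteAfterSecond (s : List Stone) : ℕ := whiteAfterBlack s.tail

theorem whiteAfterSecond_of_eq {r t : List Stone} {q : ℕ}
    (h : r = t ++ List.replicate q black) : whiteAfterSecond r = whiteAfterSecond t := by
  subst h
  unfold whiteAfterSecond
  rcases t with _ | ⟨x, t⟩
  · have := whiteAfterBlack_append_replicate_black [] (q - 1)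
    simpa using this
  · simp

/-- What a Right move can change: at most one white stone dies, and the number of white stones
behind the second black stone can drop only in special cases. -/
theorem RightMove.count {s t : List Stone} (hs : AllAlive s) (h : RightMove s t) :
    t.count black ≤ s.count black ∧ s.count white ≤ t.count white + 1 ∧
      (whiteAfterSecond s ≤ whiteAfterSecond t ∨
        whiteAfterSecond s = whiteAfterSecond t + 1 ∧
          (s.count white ≤ t.count white ∨ whiteAfterSecond s = s.count white)) := by
  obtain ⟨u, n, v, rfl, rfl⟩ := rightMove_iff.1 h
  obtain ⟨ht, p, q, hr⟩ := removeDead_spec (u ++ white :: (List.replicate (n + 1) black ++ v))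
  set t := removeDead (u ++ white :: (List.replicate (n + 1) black ++ v)) with htdef
  have hw := congrArg (List.count white) hr
  have hb := congrArg (List.count black) hr
  simp [List.count_replicate] at hw hb
  rcases u with _ | ⟨x, u⟩
  -- With nothing in front, the moved white stone dies, and it alone among the white ones. If it
  -- jumped one black stone, the count behind the second black stone is unchanged; if it jumped
  -- more, all white stones were behind the second black stone.
  · have hp : p = 1 := by
      rcases p with _ | _ | p
      · rcases allAlive_iff.1 ht with h0 | ⟨m, h0⟩ <;> rw [h0] at hr
        · cases q <;> simp [List.replicate_succ] at hr
        · simp at hr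
      · rfl
      · simp [List.replicate_succ] at hr
    subst hp
    have hr' : List.replicate (n + 1) black ++ v = t ++ List.replicate q black := by
      simpa using hr
    have hc := whiteAfterSecond_of_eq hr'
    rw [← hc]
    simp only [List.count_nil] at hw hb
    simp [List.count_replicate]
    refine ⟨by omega, by omega, ?_⟩
    cases n with
    | zero => simp [whiteAfterSecond]
    | succ n => simp [whiteAfterSecond, List.replicate_succ, List.count_replicate]
  · obtain rfl : x = black := by
      rcases allAlive_iff.1 hs with h0 | ⟨m, h0⟩
      · simp at h0
      · simp at h0; exact h0.1
    -- The first black stone stays in place, so no white stone dies; the moved one may pass the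
    -- second black stone.
    have hp : p = 0 := by
      rcases p with _ | p
      · rfl
      · simp [List.replicate_succ] at hr
    subst hp
    have hc := whiteAfterSecond_of_eq (by simpa using hr)
    rw [← hc]
    have := whiteAfterBlack_swap_le u v n
    simp at hw hb
    simp [List.count_replicate, whiteAfterSecond] at this ⊢
    omega

theorem RightMove.weight_le {s t : List Stone} (hs : AllAlive s) (h : RightMove s t) :
    weight s ≤ weight t + 1 := by
  have := h.count hs
  unfold weight
  omega

theorem AllAlive.eq_nil {s : List Stone} (hs : AllAlive s) (h : s.count black = 0) : s = [] := by
  rcases allAlive_iff.1 hs with rfl | ⟨m, rfl⟩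
  · rfl
  · simp at h

-- The last black stone and its death

theorem exists_last_black {s : List Stone} (h : black ∈ s) :
    ∃ x q, s = x ++ black :: List.replicate q white := by
  induction s using List.reverseRecOn with
  | nil => simp at h
  | append_singleton s a ih =>
    cases a
    · exact ⟨s, 0, by simp⟩
    · obtain ⟨x, q, rfl⟩ := ih (by simpa using h)
      exact ⟨x, q + 1, by simp [List.replicate_succ']⟩

theorem AllAlive.exists_last_black {s : List Stone} (hs : AllAlive s) (h : s ≠ []) :
    ∃ x q, s = x ++ black :: List.replicate (q + 1) white := by
  rcases allAlive_iff.1 hs with rfl | ⟨m, rfl⟩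
  · exact absurd rfl h
  · obtain ⟨x, q, hx⟩ := Bipass.exists_last_black (s := black :: m) (by simp)
    refine ⟨x, q, ?_⟩
    rw [← List.cons_append, hx]
    simp [List.replicate_succ']

theorem AllAlive.eq_single {s : List Stone} (hs : AllAlive s) (h : s.count black = 1) :
    ∃ q, s = black :: List.replicate (q + 1) white := by
  obtain ⟨x, q, rfl⟩ := hs.exists_last_black (by rintro rfl; simp at h)
  rcases x with _ | ⟨y, x⟩
  · exact ⟨q, rfl⟩
  · have : y = black := by
      rcases allAlive_iff.1 hs with h0 | ⟨m, h0⟩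
      · simp at h0
      · simp at h0; exact h0.1
    subst this
    simp [List.count_replicate] at h

theorem AllAlive.eq_two {s : List Stone} (hs : AllAlive s) (h : 2 ≤ s.count black) :
    ∃ x q, s = black :: (x ++ black :: List.replicate (q + 1) white) := by
  obtain ⟨x, q, rfl⟩ := hs.exists_last_black (by rintro rfl; simp at h)
  rcases x with _ | ⟨y, x⟩
  · simp [List.count_replicate] at h
  · have : y = black := by
      rcases allAlive_iff.1 hs with h0 | ⟨m, h0⟩
      · simp at h0
      · simp at h0; exact h0.1
    subst this
    exact ⟨x, q, rfl⟩

theorem leftMove_single (q : ℕ) : LeftMove (black :: List.replicate (q + 1) white) [] :=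
  leftMove_iff.2 ⟨[], q, [], by simp, by simpa using (removeDead_eq allAlive_nil (q + 1) 1).symm⟩

/-- The last black stone jumps all trailing white stones and dies; the first black stone keeps the
white stones alive. -/
theorem leftMove_kill (x : List Stone) (q : ℕ) :
    LeftMove (black :: (x ++ black :: List.replicate (q + 1) white))
      (black :: (x ++ List.replicate (q + 1) white)) := by
  refine leftMove_iff.2 ⟨black :: x, q, [], by simp, ?_⟩
  have := removeDead_eq (allAlive_black_append_white (x ++ List.replicate q white)) 0 1
  simpa [List.replicate_succ'] using this.symm

theorem allAlive_append_replicate_white (x : List Stone) (q : ℕ) :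
    AllAlive (black :: (x ++ List.replicate (q + 1) white)) := by
  have := allAlive_black_append_white (x ++ List.replicate q white)
  simpa [List.replicate_succ'] using this

/-- Left can always let one black stone die, provided that there are two. -/
theorem AllAlive.exists_kill {s : List Stone} (hs : AllAlive s) (h : 2 ≤ s.count black) :
    ∃ t, LeftMove s t ∧ AllAlive t ∧ weight t = weight s + 1 ∧
      (3 ≤ s.count black → whiteAfterSecond t = whiteAfterSecond s) := by
  obtain ⟨x, q, rfl⟩ := hs.eq_two h
  refine ⟨_, leftMove_kill x q, allAlive_append_replicate_white x q, ?_, fun h3 => ?_⟩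
  · simp [weight, List.count_replicate]; omega
  · have hx : black ∈ x := by
      simpa [List.count_replicate] using h3
    simp [whiteAfterSecond, whiteAfterBlack_append hx]

-- The strips of the theorem and their moves

/-- The strip `•∘ᵃ•ᵇ∘`. -/
def blockStrip (a b : ℕ) : List Stone :=
  black :: (List.replicate a white ++ List.replicate b black ++ [white])

theorem allAlive_blockStrip (a b : ℕ) : AllAlive (blockStrip a b) :=
  allAlive_black_append_white _

theorem weight_blockStrip (a b : ℕ) : weight (blockStrip a b) = a - b := by
  simp [weight, blockStrip, List.count_replicate]

theorem flipRow_blockStrip (a b : ℕ) : flipRow (blockStrip a b) = blockStrip b a := by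
  simp [blockStrip]

theorem leftMove_blockStrip (a b : ℕ) :
    LeftMove (blockStrip a (b + 1)) (blockStrip a b) := by
  have := leftMove_kill (List.replicate a white ++ List.replicate b black) 0
  simpa [blockStrip, List.replicate_succ'] using this

/-- Right either moves the final white stone, whereupon the black stones it jumps die, or brings the
first white stone of the inner block to the front, where it dies. -/
theorem RightMove.of_blockStrip {a b : ℕ} {t : List Stone} (h : RightMove (blockStrip a b) t) :
    weight (blockStrip a b) + 1 ≤ weight t ∨ (∃ a', a = a' + 1 ∧ t = blockStrip a' b) ∨
      (a = 0 ∧ b = 0 ∧ t = []) := by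
  obtain ⟨u, n, v, hs, rfl⟩ := rightMove_iff.1 h
  rw [weight_blockStrip]
  -- No black stone precedes a white one inside the strip, so an inner white stone can jump only the
  -- leading black stone.
  have hsort : (List.replicate a white ++ List.replicate b black).Pairwise
      (fun x y => ¬ (x = black ∧ y = white)) := by
    simp [List.pairwise_append, List.pairwise_replicate]
  rcases v.eq_nil_or_concat' with rfl | ⟨v, y, rfl⟩
  · have hs' : black :: (List.replicate a white ++ List.replicate b black) =
        u ++ List.replicate (n + 1) black := by
      have : (black :: (List.replicate a white ++ List.replicate b black)) ++ [white] =
        (u ++ List.replicate (n + 1) black) ++ [white] := by simpa [blockStrip] using hs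
      exact List.append_cancel_right this
    have hw := congrArg (List.count white) hs'
    have hb := congrArg (List.count black) hs'
    simp [List.count_replicate] at hw hb
    rcases u with _ | ⟨x, u⟩
    · have h0 : removeDead (white :: List.replicate (n + 1) black) = [] := by
        simpa using removeDead_eq allAlive_nil 1 (n + 1)
      simp [h0, weight] at hw hb ⊢
      omega
    · obtain rfl : black = x := by simp at hs'; exact hs'.1
      have h0 : removeDead (black :: (u ++ white :: List.replicate (n + 1) black)) =
          black :: (u ++ [white]) := by
        simpa using removeDead_eq (allAlive_black_append_white u) 0 (n + 1)
      left
      simp [h0, weight] at hw hb ⊢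
      omega
  · have hs' : black :: (List.replicate a white ++ List.replicate b black) =
          u ++ (List.replicate (n + 1) black ++ white :: v) ∧ white = y := by
      have : (black :: (List.replicate a white ++ List.replicate b black)) ++ [white] =
        (u ++ (List.replicate (n + 1) black ++ white :: v)) ++ [y] := by simpa [blockStrip] using hs
      simpa using List.append_inj' this rfl
    obtain ⟨hs', rfl⟩ := hs'
    rcases u with _ | ⟨x, u⟩
    · simp [List.replicate_succ] at hs'
      rcases n with _ | n
      · rcases a with _ | a
        · have := congrArg (List.count white) hs'
          simp [List.count_replicate] at this
        · right; left
          refine ⟨a, rfl, ?_⟩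
          simp [List.replicate_succ] at hs'
          subst hs'
          simpa [blockStrip] using removeDead_eq (allAlive_blockStrip a b) 1 0
      · rw [hs', List.pairwise_append] at hsort
        exact absurd (hsort.2.2 black (by simp) white (by simp)) (by simp)
    · have h1 : List.replicate a white ++ List.replicate b black =
        u ++ (List.replicate (n + 1) black ++ white :: v) := by simp at hs'; simpa using hs'.2
      rw [h1, ← List.append_assoc, List.pairwise_append] at hsort
      exact absurd (hsort.2.2 black (by simp) white (by simp)) (by simp)

/-! ### Comparison of strips with `0` and with multiples -/

theorem Le.game_of_right {G : Game} {s : List Stone} (hl : ∀ G' ∈ G.leftOptions, Lf G' (game s))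
    (hr : ∀ t, RightMove s t → Lf G (game t)) : Le G (game s) := by
  refine .intro hl fun H hH => ?_
  obtain ⟨t, ht, rfl⟩ := mem_rightOptions_game.1 hH
  exact hr t ht

theorem LeftMove.lf {G : Game} {s t : List Stone} (h : LeftMove s t) (hle : Le G (game t)) :
    Lf G (game s) :=
  .left _ (mem_leftOptions_game.2 ⟨t, h, rfl⟩) hle

theorem not_rightMove_nil (t : List Stone) : ¬ RightMove [] t :=
  fun h => by simpa [pairs] using h.pairs_lt

theorem zero_le_game_nil : Le zero (game []) :=
  Le.game_of_right (by simp) fun t ht => absurd ht (not_rightMove_nil t)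

theorem multiple_le_game_nil {j : ℤ} (hj : j < 0) : Le (multiple j) (game []) := by
  refine Le.game_of_right ?_ fun t ht => absurd ht (not_rightMove_nil t)
  rw [leftOptions_multiple_of_neg hj]
  rintro _ rfl
  exact .right zero (by rw [rightOptions_multiple_of_nonpos (by omega)]; rfl) zero_le_game_nil

theorem weight_eq {s : List Stone} : weight s = s.count white - s.count black := rfl

/-- Comparison with `0`: a strip of weight at least `1` is nonnegative, and Left, moving first,
wins a nonempty strip of nonnegative weight. -/
theorem zero_lf_and_le_game {s : List Stone} (hs : AllAlive s) :
    (s ≠ [] → 0 ≤ weight s → Lf zero (game s)) ∧ (1 ≤ weight s → Le zero (game s)) := by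
  induction h : pairs s using Nat.strong_induction_on generalizing s with
  | _ N ih =>
    subst h
    constructor
    · intro hne hw
      have h0 : s.count black ≠ 0 := fun h0 => hne (hs.eq_nil h0)
      rcases (show s.count black = 1 ∨ 2 ≤ s.count black by omega) with h1 | h2
      · obtain ⟨q, rfl⟩ := hs.eq_single h1
        exact (leftMove_single q).lf zero_le_game_nil
      · obtain ⟨t, ht, hta, htw, -⟩ := hs.exists_kill h2
        exact ht.lf ((ih _ ht.pairs_lt hta rfl).2 (by omega))
    · intro hw
      -- The strip cannot vanish: it would have had at most one white stone, hence no black one at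
      -- weight at least one.
      refine Le.game_of_right (by simp) fun t ht => ?_
      have hc := ht.count hs
      have hwt := ht.weight_le hs
      refine (ih _ ht.pairs_lt ht.allAlive rfl).1 ?_ (by omega)
      rintro rfl
      simp only [List.count_nil] at hc
      rw [weight_eq] at hw
      have := hs.eq_nil (by omega)
      subst this
      simp at hw

/-- Comparison with multiples of distinct weight. -/
theorem multiple_lf_and_le_game {s : List Stone} (hs : AllAlive s) (j : ℤ) :
    (j + 1 ≤ weight s → Lf (multiple j) (game s)) ∧
      (j + 2 ≤ weight s → Le (multiple j) (game s)) := by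
  induction h : pairs s using Nat.strong_induction_on generalizing s j with
  | _ N ih =>
    subst h
    have hr : ∀ j, j + 2 ≤ weight s → ∀ t, RightMove s t → Lf (multiple j) (game t) := by
      intro j hj t ht
      have := ht.weight_le hs
      exact (ih _ ht.pairs_lt ht.allAlive j rfl).1 (by omega)
    have h2 : ∀ j, 0 ≤ j → j + 2 ≤ weight s → Le (multiple j) (game s) := by
      intro j h0 hj
      refine Le.game_of_right ?_ (hr j hj)
      rw [leftOptions_multiple_of_nonneg h0]
      rintro _ rfl
      refine (zero_lf_and_le_game hs).1 ?_ (by omega)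
      rintro rfl
      simp [weight] at hj
      omega
    have h1 : ∀ j, j + 1 ≤ weight s → Lf (multiple j) (game s) := by
      intro j hj
      -- With two black stones Left lets one die. With fewer, she uses a Right option of `multiple
      -- j`, except for a single black stone and `j < 0`, where she empties the strip.
      rcases (show s.count black = 0 ∨ s.count black = 1 ∨ 2 ≤ s.count black by omega) with
        hb | hb | hb
      · obtain rfl := hs.eq_nil hb
        refine .right zero ?_ zero_le_game_nil
        rw [rightOptions_multiple_of_nonpos (by simp [weight] at hj; omega)]
        rfl
      · rcases lt_trichotomy j 0 with hj0 | rfl | hj0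
        · obtain ⟨q, rfl⟩ := hs.eq_single hb
          exact (leftMove_single q).lf (multiple_le_game_nil hj0)
        · exact .right zero (by rw [rightOptions_multiple_of_nonpos le_rfl]; rfl)
            ((zero_lf_and_le_game hs).2 (by omega))
        · exact .right (multiple (j - 1)) (by rw [rightOptions_multiple_of_pos hj0]; rfl)
            (h2 (j - 1) (by omega) (by omega))
      · obtain ⟨t, ht, hta, htw, -⟩ := hs.exists_kill hb
        exact ht.lf ((ih _ ht.pairs_lt hta j rfl).2 (by omega))
    refine ⟨h1 j, fun hj => ?_⟩
    rcases le_or_gt 0 j with h0 | h0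
    · exact h2 j h0 hj
    · refine Le.game_of_right ?_ (hr j hj)
      rw [leftOptions_multiple_of_neg h0]
      rintro _ rfl
      exact h1 (j + 1) (by omega)

theorem multiple_le_game_blockStrip (a b : ℕ) :
    Le (multiple (a - b)) (game (blockStrip a b)) := by
  induction h : a + b using Nat.strong_induction_on generalizing a b with
  | _ N ih =>
    subst h
    have hs := allAlive_blockStrip a b
    refine Le.game_of_right ?_ fun t ht => ?_
    · rcases le_or_gt b a with hab | hab
      · rw [leftOptions_multiple_of_nonneg (by omega)]
        rintro _ rfl
        exact (zero_lf_and_le_game hs).1 (by simp [blockStrip]) (by rw [weight_blockStrip]; omega)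
      · rw [leftOptions_multiple_of_neg (by omega)]
        rintro _ rfl
        obtain ⟨b, rfl⟩ := Nat.exists_eq_add_of_le' (show 1 ≤ b by omega)
        refine (leftMove_blockStrip a b).lf ?_
        have := ih (a + b) (by omega) a b rfl
        convert this using 2
        push_cast; ring
    · rcases ht.of_blockStrip with hw | ⟨a, rfl, rfl⟩ | ⟨rfl, rfl, rfl⟩
      · rw [weight_blockStrip] at hw
        exact (multiple_lf_and_le_game ht.allAlive _).1 hw
      -- A white stone died. Left restores the weight by a black death if the second block is
      -- nonempty; otherwise the answer is the Right option of the multiple.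
      · rcases b with _ | b
        · refine .right (multiple (a - (0 : ℕ))) ?_ (ih _ (by omega) a 0 rfl)
          rw [rightOptions_multiple_of_pos (by push_cast; omega)]
          simp
        · refine (leftMove_blockStrip a b).lf ?_
          have := ih (a + b) (by omega) a b rfl
          convert this using 2
          push_cast; ring
      · exact .right zero (by rw [rightOptions_multiple_of_nonpos (by simp)]; rfl)
          zero_le_game_nil

/-- The upper bound is the lower bound for the mirror strip `blockStrip b a`, negated. -/
theorem valueEq_game_blockStrip (a b : ℕ) :
    ValueEq (game (blockStrip a b)) (multiple (a - b)) := by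
  refine valueEq_iff_outcomeLe.2 ⟨?_, (multiple_le_game_blockStrip a b).outcomeLe⟩
  have h := (multiple_le_game_blockStrip b a).outcomeLe.neg
  rw [neg_multiple, neg_sub] at h
  refine OutcomeLe.trans ?_ h
  have := (valueEq_iff_outcomeLe.1 (valueEq_game_flipRow (blockStrip b a))).1
  rwa [flipRow_blockStrip] at this

/-- If at least two white stones follow the second black stone of a strip, and the weight `w` is
nonnegative, then Left, moving first, wins against the multiple of the same weight. -/
theorem multiple_weight_lf_game {s : List Stone} (hs : AllAlive s) (hc : 2 ≤ whiteAfterSecond s) :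
    (0 ≤ weight s → Lf (multiple (weight s)) (game s)) ∧
      (1 ≤ weight s → Le (multiple (weight s - 1)) (game s)) := by
  induction h : pairs s using Nat.strong_induction_on generalizing s with
  | _ N ih =>
    subst h
    have hb : 2 ≤ s.count black := by
      have := count_black_pos_of_whiteAfterBlack_pos (s := s.tail)
        (by unfold whiteAfterSecond at hc; omega)
      rcases allAlive_iff.1 hs with rfl | ⟨m, rfl⟩
      · simp at this
      · simp at this ⊢; omega
    constructor
    · intro hw
      rcases hb.eq_or_lt with h2 | h3
      · obtain ⟨x, q, rfl⟩ := hs.eq_two hb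
        obtain ⟨p, rfl⟩ := exists_eq_replicate_of_notMem (x := black) (y := white) (m := x)
          (by simp) (by
            rw [← List.count_eq_zero]
            simp [List.count_replicate] at h2 ⊢
            exact h2)
        obtain ⟨q, rfl⟩ := Nat.exists_eq_add_of_le' (show 1 ≤ q by
          simpa [whiteAfterSecond] using hc)
        -- With exactly two black stones a death would leave only one. Left instead moves the second
        -- over all but the last white stone: no stone dies, and a block strip of the same weight
        -- results.
        have hm : LeftMove (black :: (List.replicate p white ++
            black :: List.replicate (q + 1 + 1) white)) (blockStrip (p + (q + 1)) 1) := by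
          refine leftMove_iff.2 ⟨black :: List.replicate p white, q, [white], ?_, ?_⟩
          · simp [List.replicate_succ']
          · have := removeDead_eq (allAlive_blockStrip (p + (q + 1)) 1) 0 0
            simp only [blockStrip, List.replicate_add] at this ⊢
            simpa using this.symm
        refine hm.lf ?_
        convert multiple_le_game_blockStrip (p + (q + 1)) 1 using 2
        simp [weight, List.count_replicate]
        ring
      · obtain ⟨t, ht, hta, htw, htc⟩ := hs.exists_kill hb
        refine ht.lf ?_
        have := (ih _ ht.pairs_lt hta (by rw [htc h3]; exact hc) rfl).2 (by omega)
        rwa [htw, add_sub_cancel_right] at this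
    · intro hw
      refine Le.game_of_right ?_ fun t ht => ?_
      · rw [leftOptions_multiple_of_nonneg (by omega)]
        rintro _ rfl
        exact (zero_lf_and_le_game hs).1 (by rintro rfl; simp at hb) (by omega)
      · have hwt := ht.weight_le hs
        have hct := ht.count hs
        rcases (show weight s ≤ weight t ∨ weight t = weight s - 1 by omega) with h1 | h1
        · exact (multiple_lf_and_le_game ht.allAlive _).1 (by omega)
        -- The weight dropped, so a white stone died. The count behind the second black stone then
        -- fell only if it included all white stones, of which there are at least three (weight at
        -- least one, two black stones); so it is still at least two.
        · rw [← h1]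
          rw [weight_eq] at hw
          have := weight_eq (s := s)
          have := weight_eq (s := t)
          exact (ih _ ht.pairs_lt ht.allAlive (by omega) rfl).1 (by omega)

/-! ### The strips of the values `k · ↑* + *` -/

/-- The weight alone does not separate the empty strip from `*`, as both belong to `k = 0`. -/
theorem multiple_not_valueEq_game_nil (k : ℤ) : ¬ ValueEq (game []) (multiple k) := by
  rcases le_or_gt k 0 with hk | hk
  · exact (Lf.right zero (by rw [rightOptions_multiple_of_nonpos hk]; rfl)
      zero_le_game_nil).not_valueEq
  · intro h
    have h' := (valueEq_game_flipRow []).trans h.neg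
    rw [neg_multiple] at h'
    exact (Lf.right zero (by rw [rightOptions_multiple_of_nonpos (by omega)]; rfl)
      zero_le_game_nil).not_valueEq h'

theorem weight_eq_of_valueEq {s : List Stone} (hs : AllAlive s) {k : ℤ}
    (h : ValueEq (game s) (multiple k)) : weight s = k := by
  have key : ∀ {s : List Stone}, AllAlive s → ∀ {k : ℤ}, ValueEq (game s) (multiple k) →
      weight s ≤ k := by
    intro s hs k h
    by_contra hc
    exact ((multiple_lf_and_le_game hs k).1 (by omega)).not_valueEq h
  refine le_antisymm (key hs h) ?_
  have h' := (valueEq_game_flipRow s).trans h.neg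
  rw [neg_multiple] at h'
  have := key hs.flipRow h'
  rw [weight_eq, (count_flipRow s).1, (count_flipRow s).2] at this
  rw [weight_eq]
  omega

/-- The only white stone behind the second black stone must be the last stone of the strip, so
everything between these two is black. -/
theorem eq_blockStrip_of_whiteAfterSecond_le {s : List Stone} (hs : AllAlive s)
    (hb : 2 ≤ s.count black) (hc : whiteAfterSecond s ≤ 1) : ∃ a b, s = blockStrip a b := by
  obtain ⟨x, q, rfl⟩ := hs.eq_two hb
  obtain ⟨a, l, rfl, hl⟩ := exists_eq_replicate_white_append x
  simp only [whiteAfterSecond, List.tail_cons, List.append_assoc,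
    whiteAfterBlack_replicate_white_append] at hc
  rcases hl with rfl | ⟨l, rfl⟩
  · simp at hc
    subst hc
    exact ⟨a, 1, by simp [blockStrip]⟩
  · simp at hc
    obtain ⟨b, rfl⟩ := exists_eq_replicate_of_notMem (x := white) (y := black) (m := l)
      (by simp) (by rw [← List.count_eq_zero]; omega)
    obtain rfl : q = 0 := by omega
    exact ⟨a, b + 2, by simp [blockStrip, List.replicate_succ, replicate_append_cons]⟩

theorem exists_eq_blockStrip_of_valueEq {s : List Stone} (hs : AllAlive s) {k : ℕ}
    (h : ValueEq (game s) (multiple k)) : ∃ n, s = blockStrip (n + k) n := by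
  have hw := weight_eq_of_valueEq hs h
  have hne : s ≠ [] := by
    rintro rfl
    exact multiple_not_valueEq_game_nil _ h
  obtain ⟨a, b, rfl⟩ : ∃ a b, s = blockStrip a b := by
    have h0 : s.count black ≠ 0 := fun h0 => hne (hs.eq_nil h0)
    rcases (show s.count black = 1 ∨ 2 ≤ s.count black by omega) with hb | hb
    · obtain ⟨q, rfl⟩ := hs.eq_single hb
      exact ⟨q, 0, by simp [blockStrip, List.replicate_succ']⟩
    · refine eq_blockStrip_of_whiteAfterSecond_le hs hb ?_
      by_contra hc
      have := (multiple_weight_lf_game hs (by omega)).1 (by omega)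
      rw [hw] at this
      exact this.not_valueEq h
  rw [weight_blockStrip] at hw
  exact ⟨b, by congr 1; omega⟩

theorem valueEq_multiple_iff {s : List Stone} (hs : AllAlive s) (k : ℕ) :
    ValueEq (game s) (add (copies k upStar) star) ↔ ∃ n, s = blockStrip (n + k) n := by
  refine ⟨fun h => exists_eq_blockStrip_of_valueEq hs (h.trans (valueEq_multiple k)), ?_⟩
  rintro ⟨n, rfl⟩
  refine ValueEq.trans ?_ (valueEq_multiple k).symm
  simpa using valueEq_game_blockStrip (n + k) n

theorem valueEq_downStar_iff (s : List Stone) (k : ℕ) :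
    ValueEq (game s) (add (copies k downStar) star) ↔
      ValueEq (game (flipRow s)) (add (copies k upStar) star) := by
  rw [← neg_copies_downStar k]
  refine ⟨fun h => (valueEq_game_flipRow s).trans h.neg, fun h => ?_⟩
  simpa using ((valueEq_game_flipRow s).symm.trans h).neg

end Bipass

theorem mainTheorem2 (s : List Bipass.Stone) (hs : Bipass.AllAlive s) (k : ℕ) :
    ((Bipass.game s).ValueEq
        (Bipass.Game.add (Bipass.Game.copies k Bipass.Game.upStar) Bipass.Game.star) ↔
      ∃ n : ℕ, s = [Bipass.Stone.black] ++ List.replicate (n + k) Bipass.Stone.white ++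
        List.replicate n Bipass.Stone.black ++ [Bipass.Stone.white]) ∧
    ((Bipass.game s).ValueEq
        (Bipass.Game.add (Bipass.Game.copies k Bipass.Game.downStar) Bipass.Game.star) ↔
      ∃ n : ℕ, s = [Bipass.Stone.black] ++ List.replicate n Bipass.Stone.white ++
        List.replicate (n + k) Bipass.Stone.black ++ [Bipass.Stone.white]) := by
  constructor
  · rw [Bipass.valueEq_multiple_iff hs]
    simp [Bipass.blockStrip]
  · rw [Bipass.valueEq_downStar_iff, Bipass.valueEq_multiple_iff hs.flipRow]
    refine exists_congr fun n => ?_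
    rw [← Bipass.flipRow_blockStrip, Bipass.flipRow_injective.eq_iff]
    simp [Bipass.blockStrip]
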